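/- Let $n\ge 1$ and let $A=[a_{ij}]\in\mathbb R^{n\times n}$ be a real matrix (entries of either sign) with $a_{ii}=0$ for all $i$. Let $\mathcal G(A)$ be the signed digraph on $\{1,\dots,n\}$ with an edge from $j$ to $i$ if and only if $a_{ij}\neq 0$. Put $d_i=\sum_j|a_{ij}|$, $\Delta=\max_i d_i$ and $L=\mathrm{diag}(d_1,\dots,d_n)-A$. Let $0<\kappa<1/\Delta$ (with $1/\Delta=\infty$ if $\Delta=0$), and consider the discrete-time system $$x(k+1)=x(k)-\kappa Lx(k),\qquad x(k)\in\mathbb R^n,\quad k=0,1,2,\dots$$ The system is said to achieve bipartite consensus if for every initial state $x(0)\in\mathbb R^n$ all limits $c_i=\lim_{k\to\infty}x_i(k)$ exist and $|c_1|=\dots=|c_n|$, and if for some initial state this common absolute value is positive. The matrix $A$ is called essentially nonnegative if there is $\zeta\in\mathbb C^n$ with $|\zeta_i|=1$ for all $i$ such that $D_\zeta^{-1}AD_\zeta$ has nonnegative real entries, where $D_\zeta=\mathrm{diag}(\zeta_1,\dots,\zeta_n)$. The digraph $\mathcal G(A)$ has a spanning tree if some vertex has a directed path to every other vertex. Then the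 system achieves bipartite consensus if and only if $A$ is essentially nonnegative and $\mathcal G(A)$ has a spanning tree. In this case there is $\sigma\in\{\pm1\}^n$ such that $D_\sigma AD_\sigma$ is a nonnegative matrix. Moreover, for each such $\sigma$ there is $\eta\in\mathbb R^n$ of the form $\eta=D_\sigma\nu$, with $\nu$ entrywise nonnegative, such that $\eta^TL=0$ and $\|\eta\|_1=\sum_i|\eta_i|=1$; and for each such $\sigma$ and $\eta$ and every initial state $x(0)\in\mathbb R^n$, $$\lim_{k\to\infty}x(k)=(\eta^Tx(0))\,\sigma .$$ -/

import Mathlib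

open Filter Topology

namespace SignedConsensus

/-- The digraph of a square matrix `A`: there is an edge from `j` to `i` iff `A i j ≠ 0`. -/
def assocDigraph {n : ℕ} (A : Matrix (Fin n) (Fin n) ℝ) : Digraph (Fin n) where
  Adj j i := A i j ≠ 0

/-- Some vertex (a root) is joined by a directed path to every other vertex. -/
def HasSpanningTree {n : ℕ} (G : Digraph (Fin n)) : Prop :=
  ∃ r, ∀ i, Relation.ReflTransGen G.Adj r i

/-- The modulus degree `d i = ∑ j, |a i j|`; the indices with `a i j = 0` contribute nothing. -/
def modDegree {n : ℕ} (A : Matrix (Fin n) (Fin n) ℝ) (i : Fin n) : ℝ :=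
  ∑ j, |A i j|

/-- The maximum modulus degree `Δ`. -/
noncomputable def maxDegree {n : ℕ} [NeZero n] (A : Matrix (Fin n) (Fin n) ℝ) : ℝ :=
  Finset.univ.sup' Finset.univ_nonempty (modDegree A)

/-- The Laplacian `L = D - A`, where `D` is the modulus degree matrix. -/
def laplacian {n : ℕ} (A : Matrix (Fin n) (Fin n) ℝ) : Matrix (Fin n) (Fin n) ℝ :=
  Matrix.diagonal (modDegree A) - A

/-- Switching equivalence of complex matrices: `A₂ = D_ζ⁻¹ A₁ D_ζ` with all `ζ i` on the
unit circle. -/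
def SwitchingEquivalent {n : ℕ} (A₁ A₂ : Matrix (Fin n) (Fin n) ℂ) : Prop :=
  ∃ ζ : Fin n → ℂ, (∀ i, ‖ζ i‖ = 1) ∧
    A₂ = (Matrix.diagonal ζ)⁻¹ * A₁ * Matrix.diagonal ζ

/-- A complex matrix is essentially nonnegative if it is switching equivalent to a matrix with
nonnegative real entries. -/
def EssentiallyNonneg {n : ℕ} (A : Matrix (Fin n) (Fin n) ℂ) : Prop :=
  ∃ B : Matrix (Fin n) (Fin n) ℝ, (∀ i j, 0 ≤ B i j) ∧
    SwitchingEquivalent A (B.map Complex.ofReal)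

/-- `x` is a trajectory of `x(k+1) = x(k) - κ L x(k)`. -/
def IsTrajectory {n : ℕ} (A : Matrix (Fin n) (Fin n) ℝ) (κ : ℝ) (x : ℕ → Fin n → ℝ) : Prop :=
  ∀ k, x (k + 1) = x k - κ • (laplacian A).mulVec (x k)

/-- Bipartite consensus: from every initial state the states of all agents converge, to limits
which agree up to sign, and this is not for the trivial reason that all trajectories die out:
the common absolute value of the limits is positive for some initial state (by linearity, then
for all initial states outside a proper linear subspace). -/
def AchievesBipartiteConsensus {n : ℕ} (A : Matrix (Fin n) (Fin n) ℝ) (κ : ℝ) : Prop :=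
  (∀ x, IsTrajectory A κ x →
    ∃ c : Fin n → ℝ, (∀ i, Tendsto (fun k => x k i) atTop (𝓝 (c i))) ∧
      ∀ i j, |c i| = |c j|) ∧
  ∃ x, IsTrajectory A κ x ∧
    ∃ a : ℝ, 0 < a ∧ ∀ i, Tendsto (fun k => |x k i|) atTop (𝓝 a)

/-- `σ ∈ {±1}ⁿ` and `D_σ A D_σ` is a nonnegative matrix. -/
def IsSignSwitching {n : ℕ} (A : Matrix (Fin n) (Fin n) ℝ) (σ : Fin n → ℝ) : Prop :=
  (∀ i, σ i = 1 ∨ σ i = -1) ∧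
    ∀ i j, 0 ≤ (Matrix.diagonal σ * A * Matrix.diagonal σ) i j

/-- `η = D_σ ν` with `ν` entrywise nonnegative, `ηᵀ L = 0` and `‖η‖₁ = 1`. The condition on `ν`
fixes the sign of `η` relative to that of `σ`. -/
def IsNormalizedLeftNull {n : ℕ} (A : Matrix (Fin n) (Fin n) ℝ) (σ η : Fin n → ℝ) : Prop :=
  (∃ ν : Fin n → ℝ, (∀ i, 0 ≤ ν i) ∧ η = (Matrix.diagonal σ).mulVec ν) ∧
    Matrix.vecMul η (laplacian A) = 0 ∧ ∑ i, |η i| = 1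

end SignedConsensus

/-!
With `W = I - κ L` the trajectories are `x(k) = Wᵏ x(0)`. A sign switching `σ` conjugates `W` to a
row-stochastic matrix with positive diagonal and the same digraph. If that digraph has a root, some
power has a positive column, so it contracts the oscillation `max - min` of every vector; hence the
powers converge to a matrix `1 νᵀ`, and `Wᵏ → σ ηᵀ` with `η = D_σ ν`. Since `ζ ^ 2` is constant
along edges, the phases of an essentially nonnegative real matrix can be chosen real when a root
exists.

Conversely, consensus forces `Wᵏ → Q ≠ 0` with entries of constant modulus along each column. A
nonzero column of `Q` is a null vector of `L`, and equality in the triangle inequality turns its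
signs into a sign switching. The index of that column is a root, because a nonzero entry of `Wᵏ`
comes from a path.
-/

namespace SignedConsensus

open Matrix

section MatrixPowers

variable {ι R : Type*} [Fintype ι] [DecidableEq ι]

theorem reflTransGen_of_pow_apply_ne_zero [Semiring R] {M : Matrix ι ι R} {k : ℕ} {i j : ι}
    (h : (M ^ k) i j ≠ 0) : Relation.ReflTransGen (fun j i => M i j ≠ 0) j i := by
  induction k generalizing i with
  | zero =>
    obtain rfl : i = j := not_not.1 fun hij => h (one_apply_ne hij)
    exact .refl
  | succ k ih =>
    rw [pow_succ', mul_apply] at h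
    obtain ⟨l, -, hl⟩ := Finset.exists_ne_zero_of_sum_ne_zero h
    exact (ih (right_ne_zero_of_mul hl)).tail (left_ne_zero_of_mul hl)

section Nonneg

variable [Semiring R] [PartialOrder R] [IsStrictOrderedRing R] {P : Matrix ι ι R} {i j r : ι}

theorem pow_succ_apply_pos (hP : ∀ i j, 0 ≤ P i j) (hij : 0 < P i j) {k : ℕ}
    (hj : 0 < (P ^ k) j r) : 0 < (P ^ (k + 1)) i r := by
  rw [pow_succ', mul_apply]
  exact Finset.sum_pos' (fun l _ => mul_nonneg (hP i l) (pow_apply_nonneg hP k l r))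
    ⟨j, Finset.mem_univ j, mul_pos hij hj⟩

theorem exists_pow_col_pos (hP : ∀ i j, 0 ≤ P i j) (hdiag : ∀ i, 0 < P i i)
    (hr : ∀ i, Relation.ReflTransGen (fun j i => 0 < P i j) r i) :
    ∃ N : ℕ, ∀ i, 0 < (P ^ N) i r := by
  have pow_pos_mono (i : ι) {k l : ℕ} (hkl : k ≤ l) (hk : 0 < (P ^ k) i r) :
      0 < (P ^ l) i r := by
    induction l, hkl using Nat.le_induction with
    | base => exact hk
    | succ l _ ih => exact pow_succ_apply_pos hP (hdiag i) ih
  have exists_pow_pos (i : ι) : ∃ k : ℕ, 0 < (P ^ k) i r := by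
    induction hr i with
    | refl => exact ⟨0, by simp⟩
    | tail _ hij ih => exact ih.imp' _ fun _ => pow_succ_apply_pos hP hij
  choose k hk using exists_pow_pos
  exact ⟨Finset.univ.sup k, fun i => pow_pos_mono i (Finset.le_sup (Finset.mem_univ i)) (hk i)⟩

end Nonneg

end MatrixPowers

section PowerLimits

section Monoid

variable {M : Type*} [Monoid M] [TopologicalSpace M] [SeparatelyContinuousMul M] [T2Space M]
  {a b : M}

theorem mul_limit_eq_of_tendsto_pow (h : Tendsto (fun k : ℕ => a ^ k) atTop (𝓝 b)) :
    a * b = b := by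
  refine tendsto_nhds_unique (h.const_mul a) ?_
  simpa only [Function.comp_def, pow_succ'] using h.comp (tendsto_add_atTop_nat 1)

theorem limit_mul_eq_of_tendsto_pow (h : Tendsto (fun k : ℕ => a ^ k) atTop (𝓝 b)) :
    b * a = b := by
  refine tendsto_nhds_unique (h.mul_const a) ?_
  simpa only [Function.comp_def, pow_succ] using h.comp (tendsto_add_atTop_nat 1)

end Monoid

section Matrix

variable {ι R : Type*} [Fintype ι] [DecidableEq ι] [Semiring R] [TopologicalSpace R]
  [IsTopologicalSemiring R] {M Q : Matrix ι ι R}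

theorem tendsto_pow_mulVec (h : Tendsto (fun k : ℕ => M ^ k) atTop (𝓝 Q)) (v : ι → R) :
    Tendsto (fun k : ℕ => M ^ k *ᵥ v) atTop (𝓝 (Q *ᵥ v)) :=
  ((continuous_id.matrix_mulVec continuous_const).tendsto Q).comp h

theorem vecMul_eq_of_tendsto_pow [T2Space R] {v : ι → R} (hv : v ᵥ* M = v)
    (h : Tendsto (fun k : ℕ => M ^ k) atTop (𝓝 Q)) : v ᵥ* Q = v := by
  have hpow (k : ℕ) : v ᵥ* M ^ k = v := by
    induction k with
    | zero => rw [pow_zero, vecMul_one]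
    | succ k ih => rw [pow_succ, ← vecMul_vecMul, ih, hv]
  have hlim := ((continuous_const (y := v).matrix_vecMul continuous_id).tendsto Q).comp h
  simp only [Function.comp_def, id_eq, hpow] at hlim
  exact tendsto_nhds_unique hlim tendsto_const_nhds

end Matrix

end PowerLimits

section Stochastic

theorem exists_common_limit_of_contraction {m M : ℕ → ℝ} (hm : Monotone m) (hM : Antitone M)
    (hle : ∀ k, m k ≤ M k) {N : ℕ} {q : ℝ} (hq : q < 1)
    (hcontr : ∀ k, M (k + N) - m (k + N) ≤ q * (M k - m k)) :
    ∃ c, Tendsto m atTop (𝓝 c) ∧ Tendsto M atTop (𝓝 c) := by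
  have hm_lim : Tendsto m atTop (𝓝 (⨆ k, m k)) :=
    tendsto_atTop_ciSup hm ⟨M 0, by rintro _ ⟨k, rfl⟩; exact (hle k).trans (hM k.zero_le)⟩
  have hM_lim : Tendsto M atTop (𝓝 (⨅ k, M k)) :=
    tendsto_atTop_ciInf hM ⟨m 0, by rintro _ ⟨k, rfl⟩; exact (hm k.zero_le).trans (hle k)⟩
  have hgap := hM_lim.sub hm_lim
  have hgap_nonneg : ⨆ k, m k ≤ ⨅ k, M k := le_of_tendsto_of_tendsto' hm_lim hM_lim hle
  have hgap_contr : (⨅ k, M k) - ⨆ k, m k ≤ q * ((⨅ k, M k) - ⨆ k, m k) :=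
    le_of_tendsto_of_tendsto' (hgap.comp (tendsto_add_atTop_nat N)) (hgap.const_mul q) hcontr
  have heq : ⨆ k, m k = ⨅ k, M k := by nlinarith
  exact ⟨_, hm_lim, heq ▸ hM_lim⟩

variable {ι : Type*} [Fintype ι] [DecidableEq ι]

section Bounds

variable {R : Type*} [CommRing R] [LinearOrder R] [IsStrictOrderedRing R] {P : Matrix ι ι R}
  {v : ι → R} {i r : ι} {ε a b : R}

theorem mulVec_apply_le_of_mem_rowStochastic (hP : P ∈ rowStochastic R ι)
    (hε : ε ≤ P i r) (hv : ∀ j, v j ≤ b) :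
    (P *ᵥ v) i ≤ (1 - ε) * b + ε * v r := by
  have hterm : P i r * (b - v r) ≤ ∑ j, P i j * (b - v j) :=
    Finset.single_le_sum (f := fun j => P i j * (b - v j))
      (fun j _ => mul_nonneg (hP.1 i j) (sub_nonneg.2 (hv j))) (Finset.mem_univ r)
  have hsum : ∑ j, P i j * (b - v j) = b - (P *ᵥ v) i := by
    simp only [mul_sub, Finset.sum_sub_distrib, ← Finset.sum_mul,
      sum_row_of_mem_rowStochastic hP, one_mul, mulVec, dotProduct]
  have hweight : ε * (b - v r) ≤ P i r * (b - v r) :=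
    mul_le_mul_of_nonneg_right hε (sub_nonneg.2 (hv r))
  linarith

theorem le_mulVec_apply_of_mem_rowStochastic (hP : P ∈ rowStochastic R ι)
    (hε : ε ≤ P i r) (hv : ∀ j, a ≤ v j) :
    (1 - ε) * a + ε * v r ≤ (P *ᵥ v) i := by
  have := mulVec_apply_le_of_mem_rowStochastic hP hε (v := -v) fun j => neg_le_neg (hv j)
  simp only [mulVec_neg, Pi.neg_apply] at this
  linarith

end Bounds

variable {P : Matrix ι ι ℝ} {r : ι}

theorem exists_tendsto_pow_mulVec_of_col_pos (hP : P ∈ rowStochastic ℝ ι) {N : ℕ}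
    (hN : ∀ i, 0 < (P ^ N) i r) (v : ι → ℝ) :
    ∃ c, ∀ i, Tendsto (fun k : ℕ => (P ^ k *ᵥ v) i) atTop (𝓝 c) := by
  have : Nonempty ι := ⟨r⟩
  obtain ⟨i₀, hmin⟩ := Finite.exists_min fun i => (P ^ N) i r
  let y (k : ℕ) : ι → ℝ := P ^ k *ᵥ v
  have hy (k l : ℕ) : y (k + l) = P ^ l *ᵥ y k := by
    rw [mulVec_mulVec, ← pow_add, add_comm]
  let m (k : ℕ) : ℝ := ⨅ i, y k i
  let M (k : ℕ) : ℝ := ⨆ i, y k i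
  have hmy (k : ℕ) (i : ι) : m k ≤ y k i := ciInf_le (Set.finite_range _).bddBelow i
  have hyM (k : ℕ) (i : ι) : y k i ≤ M k := le_ciSup (Set.finite_range _).bddAbove i
  have hm_step {k l : ℕ} {ε : ℝ} (hε : ∀ i, ε ≤ (P ^ l) i r) :
      (1 - ε) * m k + ε * y k r ≤ m (k + l) := le_ciInf fun i => by
    rw [hy]; exact le_mulVec_apply_of_mem_rowStochastic (pow_mem hP l) (hε i) (hmy k)
  have hM_step {k l : ℕ} {ε : ℝ} (hε : ∀ i, ε ≤ (P ^ l) i r) :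
      M (k + l) ≤ (1 - ε) * M k + ε * y k r := ciSup_le fun i => by
    rw [hy]; exact mulVec_apply_le_of_mem_rowStochastic (pow_mem hP l) (hε i) (hyM k)
  have hnonneg (i : ι) : 0 ≤ (P ^ 1) i r := (pow_mem hP 1).1 i r
  obtain ⟨c, hm, hM⟩ := exists_common_limit_of_contraction (m := m) (M := M)
    (monotone_nat_of_le_succ fun k => by simpa using hm_step hnonneg)
    (antitone_nat_of_succ_le fun k => by simpa using hM_step hnonneg)
    (fun k => (hmy k r).trans (hyM k r)) (N := N) (q := 1 - (P ^ N) i₀ r)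
    (sub_lt_self 1 (hN i₀)) fun k => by linarith [hm_step (k := k) hmin, hM_step (k := k) hmin]
  exact ⟨c, fun i => tendsto_of_tendsto_of_tendsto_of_le_of_le hm hM (hmy · i) (hyM · i)⟩

theorem exists_stationary_tendsto_pow (hP : P ∈ rowStochastic ℝ ι) (hdiag : ∀ i, 0 < P i i)
    (hr : ∀ i, Relation.ReflTransGen (fun j i => 0 < P i j) r i) :
    ∃ ν ∈ stdSimplex ℝ ι, ν ᵥ* P = ν ∧
      Tendsto (fun k : ℕ => P ^ k) atTop (𝓝 (vecMulVec 1 ν)) := by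
  obtain ⟨N, hN⟩ := exists_pow_col_pos hP.1 hdiag hr
  choose ν hν using fun j => exists_tendsto_pow_mulVec_of_col_pos hP hN (Pi.single j 1)
  simp only [mulVec_single_one, col_apply] at hν
  have hlim : Tendsto (fun k : ℕ => P ^ k) atTop (𝓝 (vecMulVec 1 ν)) := by
    refine tendsto_pi_nhds.2 fun i => tendsto_pi_nhds.2 fun j => ?_
    simpa only [vecMulVec_apply, Pi.one_apply, one_mul] using hν j i
  have hsum : ∑ j, ν j = 1 := tendsto_nhds_unique (tendsto_finsetSum _ fun j _ => hν j r) <| by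
    simpa only [sum_row_of_mem_rowStochastic (pow_mem hP _)] using tendsto_const_nhds
  refine ⟨ν, ⟨fun j => ge_of_tendsto' (hν j r) fun k => (pow_mem hP k).1 r j, hsum⟩, ?_, hlim⟩
  have hfix := limit_mul_eq_of_tendsto_pow hlim
  rw [vecMulVec_mul] at hfix
  simpa [funext_iff, vecMulVec_apply] using congrFun hfix r

end Stochastic

section Laplacian

variable {n : ℕ} {A : Matrix (Fin n) (Fin n) ℝ} {κ : ℝ}

theorem mul_modDegree_lt_one [NeZero n] (hκ : 0 ≤ κ) (hκΔ : κ * maxDegree A < 1) (i : Fin n) :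
    κ * modDegree A i < 1 :=
  (mul_le_mul_of_nonneg_left (Finset.le_sup' _ (Finset.mem_univ i)) hκ).trans_lt hκΔ

theorem laplacian_mulVec_apply (v : Fin n → ℝ) (i : Fin n) :
    (laplacian A *ᵥ v) i = modDegree A i * v i - ∑ j, A i j * v j := by
  rw [laplacian, sub_mulVec, Pi.sub_apply, mulVec_diagonal]
  rfl

/-- The matrix `I - κ L` of one step of the system, so that `x(k) = (I - κ L)ᵏ x(0)`. -/
noncomputable def updateMatrix (A : Matrix (Fin n) (Fin n) ℝ) (κ : ℝ) :
    Matrix (Fin n) (Fin n) ℝ :=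
  1 - κ • laplacian A

theorem updateMatrix_apply_self (i : Fin n) :
    updateMatrix A κ i i = 1 - κ * modDegree A i + κ * A i i := by
  simp only [updateMatrix, laplacian, Matrix.sub_apply, Matrix.smul_apply, one_apply_eq,
    diagonal_apply_eq, smul_eq_mul]
  ring

theorem updateMatrix_apply_ne {i j : Fin n} (hij : i ≠ j) : updateMatrix A κ i j = κ * A i j := by
  simp [updateMatrix, laplacian, hij]

theorem updateMatrix_mulVec (v : Fin n → ℝ) :
    updateMatrix A κ *ᵥ v = v - κ • laplacian A *ᵥ v := by
  rw [updateMatrix, sub_mulVec, one_mulVec, smul_mulVec]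

theorem isTrajectory_iff {x : ℕ → Fin n → ℝ} :
    IsTrajectory A κ x ↔ ∀ k, x k = updateMatrix A κ ^ k *ᵥ x 0 := by
  simp only [IsTrajectory, ← updateMatrix_mulVec]
  refine ⟨fun h k => ?_, fun h k => ?_⟩
  · induction k with
    | zero => rw [pow_zero, one_mulVec]
    | succ k ih => rw [h, ih, mulVec_mulVec, ← pow_succ']
  · rw [h (k + 1), h k, mulVec_mulVec, ← pow_succ']

theorem isTrajectory_updateMatrix_pow_mulVec (v : Fin n → ℝ) :
    IsTrajectory A κ fun k => updateMatrix A κ ^ k *ᵥ v :=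
  isTrajectory_iff.2 fun k => by rw [pow_zero, one_mulVec]

theorem updateMatrix_mul_eq_self_iff {ι : Type*} (hκ : κ ≠ 0) {B : Matrix (Fin n) ι ℝ} :
    updateMatrix A κ * B = B ↔ laplacian A * B = 0 := by
  rw [updateMatrix, Matrix.sub_mul, Matrix.one_mul, Matrix.smul_mul, sub_eq_self,
    smul_eq_zero_iff_right hκ]

theorem vecMul_updateMatrix_eq_self_iff (hκ : κ ≠ 0) {v : Fin n → ℝ} :
    v ᵥ* updateMatrix A κ = v ↔ v ᵥ* laplacian A = 0 := by
  rw [updateMatrix, vecMul_sub, vecMul_one, vecMul_smul, sub_eq_self, smul_eq_zero_iff_right hκ]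

theorem reflTransGen_assocDigraph_of_updateMatrix_pow_apply_ne_zero {k : ℕ} {i j : Fin n}
    (h : (updateMatrix A κ ^ k) i j ≠ 0) : Relation.ReflTransGen (assocDigraph A).Adj j i := by
  refine Relation.reflTransGen_closed (fun j i hij => ?_) _ _ (reflTransGen_of_pow_apply_ne_zero h)
  obtain rfl | hne := eq_or_ne i j
  · exact .refl
  · rw [updateMatrix_apply_ne hne] at hij
    exact .single (right_ne_zero_of_mul hij)

section Nonneg

theorem updateMatrix_apply_self_pos (hA : ∀ i j, 0 ≤ A i j) (hκ : 0 ≤ κ) {i : Fin n}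
    (hd : κ * modDegree A i < 1) : 0 < updateMatrix A κ i i := by
  rw [updateMatrix_apply_self]
  linarith [mul_nonneg hκ (hA i i)]

theorem updateMatrix_mem_rowStochastic (hA : ∀ i j, 0 ≤ A i j) (hκ : 0 ≤ κ)
    (hd : ∀ i, κ * modDegree A i < 1) : updateMatrix A κ ∈ rowStochastic ℝ (Fin n) := by
  refine mem_rowStochastic.2 ⟨fun i j => ?_, ?_⟩
  · obtain rfl | hij := eq_or_ne i j
    · exact (updateMatrix_apply_self_pos hA hκ (hd i)).le
    · exact (updateMatrix_apply_ne hij).symm ▸ mul_nonneg hκ (hA i j)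
  · have hL : laplacian A *ᵥ 1 = 0 := by
      ext i
      simp [laplacian_mulVec_apply, modDegree, abs_of_nonneg (hA i _)]
    rw [updateMatrix_mulVec, hL, smul_zero, sub_zero]

theorem exists_stationary_tendsto_updateMatrix_pow (hA : ∀ i j, 0 ≤ A i j) (hκ : 0 < κ)
    (hd : ∀ i, κ * modDegree A i < 1) (htree : HasSpanningTree (assocDigraph A)) :
    ∃ ν ∈ stdSimplex ℝ (Fin n), ν ᵥ* laplacian A = 0 ∧
      Tendsto (fun k : ℕ => updateMatrix A κ ^ k) atTop (𝓝 (vecMulVec 1 ν)) := by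
  obtain ⟨r, hr⟩ := htree
  simp only [← vecMul_updateMatrix_eq_self_iff hκ.ne']
  have hdiag (i : Fin n) := updateMatrix_apply_self_pos hA hκ.le (hd i)
  refine exists_stationary_tendsto_pow (r := r) (updateMatrix_mem_rowStochastic hA hκ.le hd) hdiag
    fun i => Relation.ReflTransGen.mono (fun j i hji => ?_) _ _ (hr i)
  obtain rfl | hij := eq_or_ne i j
  · exact hdiag i
  · exact (updateMatrix_apply_ne hij).symm ▸ mul_pos hκ ((hA i j).lt_of_ne' hji)

end Nonneg

end Laplacian

section SignSwitching

variable {n : ℕ} {A : Matrix (Fin n) (Fin n) ℝ} {κ : ℝ} {σ η : Fin n → ℝ}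

theorem modDegree_map_abs : modDegree (A.map abs) = modDegree A := by
  simp [modDegree, funext_iff]

theorem assocDigraph_map_abs : assocDigraph (A.map abs) = assocDigraph A := by
  simp [assocDigraph]

theorem isSignSwitching_iff : IsSignSwitching A σ ↔
    (∀ i, σ i = 1 ∨ σ i = -1) ∧ ∀ i j, A i j * σ j = σ i * |A i j| := by
  refine and_congr_right fun hσ => forall₂_congr fun i j => ?_
  rw [mul_diagonal, diagonal_mul]
  rcases hσ i with hi | hi <;> rcases hσ j with hj | hj <;>
    simp [hi, hj, eq_comm (b := |A i j|), eq_comm (b := -|A i j|), neg_eq_iff_eq_neg]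

namespace IsSignSwitching

theorem mul_self_eq_one (h : IsSignSwitching A σ) (i : Fin n) : σ i * σ i = 1 :=
  mul_self_eq_one_iff.2 (h.1 i)

theorem abs_apply (h : IsSignSwitching A σ) (i : Fin n) : |σ i| = 1 :=
  (abs_eq zero_le_one).2 (h.1 i)

theorem diagonal_mul_self (h : IsSignSwitching A σ) : diagonal σ * diagonal σ = 1 := by
  simp only [diagonal_mul_diagonal, h.mul_self_eq_one, diagonal_one]

theorem eq_conj_map_abs (h : IsSignSwitching A σ) :
    A = diagonal σ * A.map abs * diagonal σ := by
  ext i j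
  rw [mul_diagonal, diagonal_mul, map_apply, ← (isSignSwitching_iff.1 h).2, mul_assoc,
    h.mul_self_eq_one, mul_one]

theorem laplacian_eq_conj (h : IsSignSwitching A σ) :
    laplacian A = diagonal σ * laplacian (A.map abs) * diagonal σ := by
  rw [laplacian, laplacian, modDegree_map_abs, mul_sub, sub_mul, ← h.eq_conj_map_abs,
    (commute_diagonal σ _).eq, mul_assoc, h.diagonal_mul_self, mul_one]

theorem updateMatrix_pow_eq_conj (h : IsSignSwitching A σ) (k : ℕ) :
    updateMatrix A κ ^ k = diagonal σ * updateMatrix (A.map abs) κ ^ k * diagonal σ := by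
  have hconj : updateMatrix A κ = diagonal σ * updateMatrix (A.map abs) κ * diagonal σ := by
    rw [updateMatrix, updateMatrix, mul_sub, sub_mul, mul_one, h.diagonal_mul_self,
      h.laplacian_eq_conj, Matrix.mul_smul, Matrix.smul_mul]
  let D : (Matrix (Fin n) (Fin n) ℝ)ˣ :=
    ⟨diagonal σ, diagonal σ, h.diagonal_mul_self, h.diagonal_mul_self⟩
  rw [hconj]
  exact D.conj_pow _ k

theorem isNormalizedLeftNull_of_mem_stdSimplex (h : IsSignSwitching A σ) {ν : Fin n → ℝ}
    (hν : ν ∈ stdSimplex ℝ (Fin n)) (hnull : ν ᵥ* laplacian (A.map abs) = 0) :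
    IsNormalizedLeftNull A σ (ν ᵥ* diagonal σ) := by
  refine ⟨⟨ν, hν.1, ?_⟩, ?_, ?_⟩
  · ext i
    rw [vecMul_diagonal, mulVec_diagonal, mul_comm]
  · rw [h.laplacian_eq_conj, vecMul_vecMul, mul_assoc, ← mul_assoc, h.diagonal_mul_self, one_mul,
      ← vecMul_vecMul, hnull, zero_vecMul]
  · simpa only [vecMul_diagonal, abs_mul, h.abs_apply, mul_one, abs_of_nonneg (hν.1 _)] using hν.2

theorem exists_tendsto_updateMatrix_pow (h : IsSignSwitching A σ) (hκ : 0 < κ)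
    (hd : ∀ i, κ * modDegree A i < 1) (htree : HasSpanningTree (assocDigraph A)) :
    ∃ η, IsNormalizedLeftNull A σ η ∧
      Tendsto (fun k : ℕ => updateMatrix A κ ^ k) atTop (𝓝 (vecMulVec σ η)) := by
  rw [← modDegree_map_abs] at hd
  rw [← assocDigraph_map_abs] at htree
  obtain ⟨ν, hν, hnull, hlim⟩ :=
    exists_stationary_tendsto_updateMatrix_pow (A := A.map abs) (fun i j => abs_nonneg (A i j)) hκ
      hd htree
  refine ⟨_, h.isNormalizedLeftNull_of_mem_stdSimplex hν hnull, ?_⟩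
  have hσ : diagonal σ *ᵥ 1 = σ := by ext i; simp [mulVec_diagonal]
  simpa only [h.updateMatrix_pow_eq_conj, mul_vecMulVec, vecMulVec_mul, hσ] using
    (hlim.const_mul (diagonal σ)).mul_const (diagonal σ)

theorem dotProduct_eq_one (h : IsSignSwitching A σ) (hη : IsNormalizedLeftNull A σ η) :
    η ⬝ᵥ σ = 1 := by
  obtain ⟨⟨ν, hν, rfl⟩, -, hnorm⟩ := hη
  rw [← hnorm]
  refine Finset.sum_congr rfl fun i _ => ?_
  rw [mulVec_diagonal, abs_mul, h.abs_apply, abs_of_nonneg (hν i), mul_right_comm,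
    h.mul_self_eq_one]

theorem tendsto_updateMatrix_pow (h : IsSignSwitching A σ) (hκ : 0 < κ)
    (hd : ∀ i, κ * modDegree A i < 1) (htree : HasSpanningTree (assocDigraph A))
    (hη : IsNormalizedLeftNull A σ η) :
    Tendsto (fun k : ℕ => updateMatrix A κ ^ k) atTop (𝓝 (vecMulVec σ η)) := by
  obtain ⟨θ, -, hlim⟩ := h.exists_tendsto_updateMatrix_pow hκ hd htree
  have hfix := vecMul_eq_of_tendsto_pow ((vecMul_updateMatrix_eq_self_iff hκ.ne').2 hη.2.1) hlim
  rw [vecMul_vecMulVec, h.dotProduct_eq_one hη, one_smul] at hfix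
  exact hfix ▸ hlim

theorem tendsto_of_isTrajectory (h : IsSignSwitching A σ) (hκ : 0 < κ)
    (hd : ∀ i, κ * modDegree A i < 1) (htree : HasSpanningTree (assocDigraph A))
    (hη : IsNormalizedLeftNull A σ η) {x : ℕ → Fin n → ℝ} (hx : IsTrajectory A κ x) :
    Tendsto x atTop (𝓝 ((η ⬝ᵥ x 0) • σ)) := by
  have hlim := tendsto_pow_mulVec (h.tendsto_updateMatrix_pow hκ hd htree hη) (x 0)
  simpa only [← isTrajectory_iff.1 hx, vecMulVec_mulVec, op_smul_eq_smul] using hlim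

theorem achievesBipartiteConsensus (h : IsSignSwitching A σ) (hκ : 0 < κ)
    (hd : ∀ i, κ * modDegree A i < 1) (htree : HasSpanningTree (assocDigraph A)) :
    AchievesBipartiteConsensus A κ := by
  obtain ⟨η, hη, -⟩ := h.exists_tendsto_updateMatrix_pow hκ hd htree
  have hlim {x : ℕ → Fin n → ℝ} (hx : IsTrajectory A κ x) (i : Fin n) :
      Tendsto (fun k => x k i) atTop (𝓝 ((η ⬝ᵥ x 0) * σ i)) :=
    tendsto_pi_nhds.1 (h.tendsto_of_isTrajectory hκ hd htree hη hx) i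
  refine ⟨fun x hx => ⟨_, hlim hx, fun i j => by simp only [abs_mul, h.abs_apply]⟩,
    _, isTrajectory_updateMatrix_pow_mulVec σ, 1, one_pos, fun i => ?_⟩
  simpa only [pow_zero, one_mulVec, h.dotProduct_eq_one hη, one_mul, h.abs_apply] using
    (hlim (isTrajectory_updateMatrix_pow_mulVec σ) i).abs

end IsSignSwitching

end SignSwitching

section EssentiallyNonneg

variable {n : ℕ}

theorem essentiallyNonneg_iff {A : Matrix (Fin n) (Fin n) ℂ} : EssentiallyNonneg A ↔
    ∃ ζ : Fin n → ℂ, (∀ i, ‖ζ i‖ = 1) ∧ ∀ i j, A i j * ζ j = ζ i * ‖A i j‖ := by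
  have eq_conj_iff {ζ : Fin n → ℂ} (hζ : ∀ i, ‖ζ i‖ = 1) (B : Matrix (Fin n) (Fin n) ℂ) :
      B = (diagonal ζ)⁻¹ * A * diagonal ζ ↔ ∀ i j, A i j * ζ j = ζ i * B i j := by
    have hunit : IsUnit (diagonal ζ).det := by
      simp [det_diagonal, ← norm_ne_zero_iff, hζ]
    have hunit' := (diagonal ζ).isUnit_iff_isUnit_det.2 hunit
    rw [← hunit'.mul_right_inj, mul_assoc, mul_nonsing_inv_cancel_left _ _ hunit, eq_comm,
      ← Matrix.ext_iff]
    simp only [mul_diagonal, diagonal_mul]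
  constructor
  · rintro ⟨B, hB, ζ, hζ, hconj⟩
    refine ⟨ζ, hζ, fun i j => ?_⟩
    have hij : A i j * ζ j = ζ i * B i j := (eq_conj_iff hζ _).1 hconj i j
    have hnorm : ‖A i j‖ = B i j := by
      simpa [hζ, abs_of_nonneg (hB i j)] using congrArg norm hij
    rw [hij, hnorm]
  · rintro ⟨ζ, hζ, h⟩
    exact ⟨A.map norm, fun i j => norm_nonneg (A i j), ζ, hζ, (eq_conj_iff hζ _).2 h⟩

variable {A : Matrix (Fin n) (Fin n) ℝ} {σ : Fin n → ℝ}

theorem IsSignSwitching.essentiallyNonneg (h : IsSignSwitching A σ) :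
    EssentiallyNonneg (A.map Complex.ofReal) := by
  refine essentiallyNonneg_iff.2 ⟨fun i => σ i, fun i => ?_, fun i j => ?_⟩
  · rw [Complex.norm_real, Real.norm_eq_abs, h.abs_apply]
  · rw [map_apply, Complex.norm_real, Real.norm_eq_abs]
    dsimp only
    exact_mod_cast (isSignSwitching_iff.1 h).2 i j

theorem EssentiallyNonneg.exists_isSignSwitching
    (h : EssentiallyNonneg (A.map Complex.ofReal)) (htree : HasSpanningTree (assocDigraph A)) :
    ∃ σ, IsSignSwitching A σ := by
  obtain ⟨ζ, hζ, hA⟩ := essentiallyNonneg_iff.1 h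
  obtain ⟨r, hr⟩ := htree
  simp only [map_apply, Complex.norm_real, Real.norm_eq_abs] at hA
  -- Squaring `A i j * ζ j = ζ i * |A i j|` shows that `ζ ^ 2` is constant along edges.
  have hsq (i : Fin n) : ζ i ^ 2 = ζ r ^ 2 := by
    induction hr i with
    | refl => rfl
    | @tail j i _ hji ih =>
      have hne : (A i j : ℂ) ^ 2 ≠ 0 := pow_ne_zero 2 (Complex.ofReal_ne_zero.2 hji)
      have habs : ((|A i j| : ℝ) : ℂ) ^ 2 = (A i j : ℂ) ^ 2 := by exact_mod_cast sq_abs (A i j)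
      have hedge := congrArg (· ^ 2) (hA i j)
      simp only [mul_pow, habs, mul_comm (ζ i ^ 2)] at hedge
      rw [← ih, mul_left_cancel₀ hne hedge]
  have hsign (i : Fin n) : ∃ s : ℝ, (s = 1 ∨ s = -1) ∧ ζ i = s * ζ r := by
    rcases sq_eq_sq_iff_eq_or_eq_neg.1 (hsq i) with hi | hi
    · exact ⟨1, .inl rfl, by simp [hi]⟩
    · exact ⟨-1, .inr rfl, by simp [hi]⟩
  choose σ hσ hζσ using hsign
  refine ⟨σ, isSignSwitching_iff.2 ⟨hσ, fun i j => ?_⟩⟩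
  have hζr : ζ r ≠ 0 := norm_ne_zero_iff.1 (by rw [hζ]; exact one_ne_zero)
  have hij : (A i j * σ j : ℂ) * ζ r = (σ i * |A i j| : ℂ) * ζ r := by
    rw [mul_assoc, mul_right_comm, ← hζσ i, ← hζσ j, hA]
  exact_mod_cast mul_right_cancel₀ hζr hij

end EssentiallyNonneg

section Necessity

variable {n : ℕ} {A : Matrix (Fin n) (Fin n) ℝ} {κ : ℝ}

theorem isSignSwitching_of_laplacian_mulVec_eq_zero {σ : Fin n → ℝ}
    (hσ : ∀ i, σ i = 1 ∨ σ i = -1) (hL : laplacian A *ᵥ σ = 0) : IsSignSwitching A σ := by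
  have habs (i : Fin n) : |σ i| = 1 := (abs_eq zero_le_one).2 (hσ i)
  have hle (i j : Fin n) : σ i * (A i j * σ j) ≤ |A i j| := by
    simpa [abs_mul, habs] using le_abs_self (σ i * (A i j * σ j))
  have hsum (i : Fin n) : ∑ j, σ i * (A i j * σ j) = ∑ j, |A i j| := by
    have hi := congrFun hL i
    rw [laplacian_mulVec_apply, Pi.zero_apply, sub_eq_zero] at hi
    rw [← Finset.mul_sum, ← hi, mul_left_comm, mul_self_eq_one_iff.2 (hσ i), mul_one, modDegree]
  refine isSignSwitching_iff.2 ⟨hσ, fun i j => ?_⟩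
  rw [← (Finset.sum_eq_sum_iff_of_le fun j _ => hle i j).1 (hsum i) j (Finset.mem_univ j),
    ← mul_assoc, mul_self_eq_one_iff.2 (hσ i), one_mul]

theorem exists_isSignSwitching_of_laplacian_mulVec_eq_zero {c : Fin n → ℝ} {a : ℝ} (ha : 0 < a)
    (hc : ∀ i, |c i| = a) (hL : laplacian A *ᵥ c = 0) : ∃ σ, IsSignSwitching A σ := by
  refine ⟨a⁻¹ • c, isSignSwitching_of_laplacian_mulVec_eq_zero (fun i => ?_) ?_⟩
  · rw [← abs_eq zero_le_one, Pi.smul_apply, smul_eq_mul, abs_mul, hc, abs_inv, abs_of_pos ha,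
      inv_mul_cancel₀ ha.ne']
  · rw [mulVec_smul, hL, smul_zero]

theorem hasSpanningTree_of_tendsto_updateMatrix_pow {Q : Matrix (Fin n) (Fin n) ℝ}
    (hQ : Tendsto (fun k : ℕ => updateMatrix A κ ^ k) atTop (𝓝 Q)) {r : Fin n}
    (hr : ∀ i, Q i r ≠ 0) : HasSpanningTree (assocDigraph A) := by
  refine ⟨r, fun i => ?_⟩
  have hir : Tendsto (fun k : ℕ => (updateMatrix A κ ^ k) i r) atTop (𝓝 (Q i r)) :=
    tendsto_pi_nhds.1 (tendsto_pi_nhds.1 hQ i) r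
  obtain ⟨k, hk⟩ := (hir.eventually_ne (hr i)).exists
  exact reflTransGen_assocDigraph_of_updateMatrix_pow_apply_ne_zero hk

namespace AchievesBipartiteConsensus

theorem exists_tendsto_updateMatrix_pow [NeZero n] (h : AchievesBipartiteConsensus A κ) :
    ∃ Q, Tendsto (fun k : ℕ => updateMatrix A κ ^ k) atTop (𝓝 Q) ∧ Q ≠ 0 ∧
      ∀ r i j, |Q i r| = |Q j r| := by
  obtain ⟨hall, x, hx, a, ha, hxa⟩ := h
  choose c hc hcabs using fun r : Fin n =>
    hall _ (isTrajectory_updateMatrix_pow_mulVec (Pi.single r 1))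
  simp only [mulVec_single_one, col_apply] at hc
  have hlim : Tendsto (fun k : ℕ => updateMatrix A κ ^ k) atTop (𝓝 (of fun i r => c r i)) :=
    tendsto_pi_nhds.2 fun i => tendsto_pi_nhds.2 fun r => hc r i
  refine ⟨_, hlim, fun hzero => ha.ne ?_, hcabs⟩
  have hx0 := tendsto_pow_mulVec (hzero ▸ hlim) (x 0)
  simp only [← isTrajectory_iff.1 hx, zero_mulVec] at hx0
  simpa using tendsto_nhds_unique (tendsto_pi_nhds.1 hx0 0).abs (hxa 0)

theorem exists_isSignSwitching_and_hasSpanningTree [NeZero n] (hκ : κ ≠ 0)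
    (h : AchievesBipartiteConsensus A κ) :
    (∃ σ, IsSignSwitching A σ) ∧ HasSpanningTree (assocDigraph A) := by
  obtain ⟨Q, hlim, hQ, habs⟩ := h.exists_tendsto_updateMatrix_pow
  obtain ⟨i, r, hir⟩ : ∃ i r, Q i r ≠ 0 := by
    contrapose! hQ
    exact Matrix.ext hQ
  have hpos : 0 < |Q i r| := abs_pos.2 hir
  have hL : laplacian A * Q = 0 :=
    (updateMatrix_mul_eq_self_iff hκ).1 (mul_limit_eq_of_tendsto_pow hlim)
  have hLcol : laplacian A *ᵥ Q.col r = 0 := funext fun j => congrFun (congrFun hL j) r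
  exact ⟨exists_isSignSwitching_of_laplacian_mulVec_eq_zero hpos (fun j => habs r j i) hLcol,
    hasSpanningTree_of_tendsto_updateMatrix_pow hlim fun j => abs_pos.1 (habs r i j ▸ hpos)⟩

end AchievesBipartiteConsensus

end Necessity

end SignedConsensus

open SignedConsensus in
theorem mainTheorem8_general {n : ℕ} [NeZero n] (A : Matrix (Fin n) (Fin n) ℝ) {κ : ℝ}
    (hκ : 0 < κ) (hκΔ : κ * maxDegree A < 1) :
    (AchievesBipartiteConsensus A κ ↔
      EssentiallyNonneg (A.map Complex.ofReal) ∧ HasSpanningTree (assocDigraph A)) ∧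
    (EssentiallyNonneg (A.map Complex.ofReal) ∧ HasSpanningTree (assocDigraph A) →
      (∃ σ, IsSignSwitching A σ) ∧
      ∀ σ, IsSignSwitching A σ →
        (∃ η, IsNormalizedLeftNull A σ η) ∧
        ∀ η, IsNormalizedLeftNull A σ η → ∀ x, IsTrajectory A κ x →
          Tendsto x atTop (𝓝 ((η ⬝ᵥ x 0) • σ))) := by
  have hd := mul_modDegree_lt_one hκ.le hκΔ
  refine ⟨⟨fun hcons => ?_, fun ⟨hnonneg, htree⟩ => ?_⟩, fun ⟨hnonneg, htree⟩ => ?_⟩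
  · obtain ⟨⟨σ, hσ⟩, htree⟩ := hcons.exists_isSignSwitching_and_hasSpanningTree hκ.ne'
    exact ⟨hσ.essentiallyNonneg, htree⟩
  · obtain ⟨σ, hσ⟩ := hnonneg.exists_isSignSwitching htree
    exact hσ.achievesBipartiteConsensus hκ hd htree
  · refine ⟨hnonneg.exists_isSignSwitching htree, fun σ hσ => ⟨?_, fun η hη x hx => ?_⟩⟩
    · exact (hσ.exists_tendsto_updateMatrix_pow hκ hd htree).imp fun _ => And.left
    · exact hσ.tendsto_of_isTrajectory hκ hd htree hη hx

theorem mainTheorem8 {n : ℕ} [NeZero n] (A : Matrix (Fin n) (Fin n) ℝ)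
    (hA : ∀ i, A i i = 0) (κ : ℝ) (hκ : 0 < κ)
    -- `κ < 1 / Δ`, where `1 / Δ` is read as `∞` if `Δ = 0`
    (hκΔ : κ * SignedConsensus.maxDegree A < 1) :
    (SignedConsensus.AchievesBipartiteConsensus A κ ↔
      SignedConsensus.EssentiallyNonneg (A.map Complex.ofReal) ∧
        SignedConsensus.HasSpanningTree (SignedConsensus.assocDigraph A)) ∧
    (SignedConsensus.EssentiallyNonneg (A.map Complex.ofReal) ∧
        SignedConsensus.HasSpanningTree (SignedConsensus.assocDigraph A) →
      (∃ σ, SignedConsensus.IsSignSwitching A σ) ∧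
      ∀ σ, SignedConsensus.IsSignSwitching A σ →
        (∃ η, SignedConsensus.IsNormalizedLeftNull A σ η) ∧
        ∀ η, SignedConsensus.IsNormalizedLeftNull A σ η →
          ∀ x, SignedConsensus.IsTrajectory A κ x →
            Tendsto x atTop (𝓝 ((η ⬝ᵥ x 0) • σ))) := by
  exact mainTheorem8_general A hκ hκΔ
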